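/- Equip $\mathbb{R}^n$ with the Euclidean norm $\|\cdot\|$, let $e_1,\dots,e_n$ be its standard basis, and for a real $n\times n$ matrix $A$ let $\|A\|=\sup\{\|Ax\|:\|x\|=1\}$ be its operator norm. There exist constants $1>d_1>d_2>d_3>0$ such that the following holds. For every positive integer $n$, every real $n\times n$ matrix $A$ with $\|Ae_i\|=1$ for $i=1,\dots,n$, and every $\sigma_1\subset\{1,\dots,n\}$ with $|\sigma_1|\le d_1n\|A\|^{-2}$, there exists $$\sigma_2\subset\{1,\dots,n\}\setminus\sigma_1\quad\text{with}\quad|\sigma_2|\ge d_2n\|A\|^{-2}$$ such that for any choice of real scalars $(a_j)_{j\in\sigma_1\cup\sigma_2}$, $$\Big\|\sum_{j\in\sigma_1\cup\sigma_2}a_jAe_j\Big\|\ge\frac{1}{16\sqrt2}\Big(\sum_{j\in\sigma_2}|a_j|^2\Big)^{1/2}.$$ If, additionally, $|\sigma_1|\ge d_2n\|A\|^{-2}$ and $d_1d_2n\|A\|^{-4}\ge1$, then there also exist $\tau_1\subset\sigma_1$ and $\tilde\sigma_2\subset\sigma_2$ (for this same $\sigma_2$) with $|\tau_1|\ge d_3n\|A\|^{-4}$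 and $|\tilde\sigma_2|\ge d_3n\|A\|^{-4}$ such that for any choice of real scalars $(a_j)_{j\in\tau_1\cup\tilde\sigma_2}$, $$\Big\|\sum_{j\in\tau_1\cup\tilde\sigma_2}a_jAe_j\Big\|\ge\frac1{32}\Big(\sum_{j\in\tau_1\cup\tilde\sigma_2}|a_j|^2\Big)^{1/2}.$$ -/

import Mathlib

/- `‖A‖` is the operator norm of the matrix `A` with respect to the Euclidean norms. -/
open scoped Matrix.Norms.L2Operator

/-- The vector `A e_j` of the Euclidean space `ℝⁿ`, where `e_j` is the `j`-th standard basis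
vector. -/
noncomputable def matrixCol {n : ℕ} (A : Matrix (Fin n) (Fin n) ℝ) (j : Fin n) :
    EuclideanSpace ℝ (Fin n) :=
  Matrix.toEuclideanLin A (EuclideanSpace.single j (1 : ℝ))

/-! Everything rests on restricted invertibility via a barrier. Let `V` have columns `v j`, `j ∈ σ`.
If `VᵀV > b`, minimizing `‖x - Va‖² - b‖a‖²` over `a` gives the quadratic form of `(1 - VVᵀ/b)⁻¹`; a
barrier `N` lies below it, and at `x = 0` certifies `VᵀV ≥ b`. The potential `∑ ⟨v j, N v j⟩` over
`S` drops by at most `12 L²` per round (lower `b`, add a vector), so about `|S| / L²` rounds are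
possible.

Projecting away from the span of a small family `ρ` costs little mean square norm, so the selected
vectors stay well conditioned modulo that span (`exists_restricted_invertibility_union`). The
theorem uses this twice: modulo `σ₁`, then inside `σ₁` modulo a small part of `σ₂`. Averaging the
two one-sided bounds gives the two-sided one. -/

section RestrictedInvertibility

variable {E : Type*} [NormedAddCommGroup E] [InnerProductSpace ℝ E] {ι : Type*}

/-! ### Barrier operators and their updates -/

/-- For a symmetric `N ≤ 1`, the operator `(1 - ε) N (1 - ε N)⁻¹`, described without inverses. -/
theorem LinearMap.IsSymmetric.exists_shift [FiniteDimensional ℝ E] {N : E →ₗ[ℝ] E}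
    (hs : N.IsSymmetric) (h1 : ∀ x, inner ℝ x (N x) ≤ ‖x‖ ^ 2) {ε : ℝ} (h0 : 0 ≤ ε) (hε : ε < 1) :
    ∃ N' : E →ₗ[ℝ] E, N'.IsSymmetric ∧
      ∀ x, ∃ y, x = y - ε • N y ∧ N' x = (1 - ε) • N y := by
  have hinj : Function.Injective (LinearMap.id - ε • N : E →ₗ[ℝ] E) := by
    rw [← LinearMap.ker_eq_bot, LinearMap.ker_eq_bot']
    intro y hy
    simp only [LinearMap.sub_apply, LinearMap.id_apply, LinearMap.smul_apply] at hy
    have h2 : inner ℝ y (y - ε • N y) = 0 := by rw [hy, inner_zero_right]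
    rw [inner_sub_right, inner_smul_right, real_inner_self_eq_norm_sq] at h2
    have h3 := mul_le_mul_of_nonneg_left (h1 y) h0
    have h4 : ‖y‖ ^ 2 = 0 := by nlinarith [sq_nonneg ‖y‖]
    simpa using h4
  let e := LinearEquiv.ofInjectiveEndo _ hinj
  have he : ∀ y, e y = y - ε • N y := fun y => rfl
  -- If `N = (1 - W/b)⁻¹`, this is `(1 - W/((1 - ε)b))⁻¹`.
  refine ⟨(1 - ε) • (N ∘ₗ e.symm.toLinearMap), ?_, fun x => ⟨e.symm x, ?_, rfl⟩⟩
  · intro x z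
    obtain ⟨y, rfl⟩ := e.surjective x
    obtain ⟨u, rfl⟩ := e.surjective z
    simp only [LinearMap.smul_apply, LinearMap.comp_apply, LinearEquiv.coe_coe,
      LinearEquiv.symm_apply_apply]
    simp only [he, inner_sub_left, inner_sub_right, real_inner_smul_left,
      real_inner_smul_right, hs y u]
    ring
  · rw [← he, LinearEquiv.apply_symm_apply]

/-- The quadratic form of `N` bounds from below the Schur complement of the shifted Gram matrix
of the vectors `v j`, `j ∈ σ`. -/
structure IsBarrier (v : ι → E) (σ : Finset ι) (b : ℝ) (N : E →ₗ[ℝ] E) : Prop where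
  symm : N.IsSymmetric
  le : ∀ (x : E) (a : ι → ℝ),
    inner ℝ x (N x) ≤ ‖x - ∑ j ∈ σ, a j • v j‖ ^ 2 - b * ∑ j ∈ σ, a j ^ 2

namespace IsBarrier

variable {v : ι → E} {σ : Finset ι} {b : ℝ} {N : E →ₗ[ℝ] E}

theorem empty (v : ι → E) (b : ℝ) : IsBarrier v ∅ b LinearMap.id :=
  ⟨fun _ _ => rfl, fun x a => by simp⟩

theorem inner_le (h : IsBarrier v σ b N) (x : E) : inner ℝ x (N x) ≤ ‖x‖ ^ 2 := by
  simpa using h.le x 0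

theorem le_norm_sum (h : IsBarrier v σ b N) (a : ι → ℝ) :
    b * ∑ j ∈ σ, a j ^ 2 ≤ ‖∑ j ∈ σ, a j • v j‖ ^ 2 := by
  have := h.le 0 a
  simp only [inner_zero_left, zero_sub, norm_neg] at this
  linarith

/-- Ensures that a vector with positive `q` in `insert` is new. -/
theorem inner_le_of_mem [DecidableEq ι] (h : IsBarrier v σ b N) {i : ι} (hi : i ∈ σ) :
    inner ℝ (v i) (N (v i)) ≤ -b := by
  have := h.le (v i) (Pi.single i 1)
  have h1 : ∑ j ∈ σ, (Pi.single i (1 : ℝ) : ι → ℝ) j • v j = v i := by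
    rw [Finset.sum_eq_single_of_mem i hi]
    · simp
    · intro j _ hj
      simp [hj]
  have h2 : ∑ j ∈ σ, (Pi.single i (1 : ℝ) : ι → ℝ) j ^ 2 = 1 := by
    rw [Finset.sum_eq_single_of_mem i hi]
    · simp
    · intro j _ hj
      simp [hj]
  rw [h1, h2] at this
  simpa using this

/-- Adding a vector. -/
theorem insert [DecidableEq ι] (h : IsBarrier v σ b N) {i : ι} (hi : i ∉ σ)
    (hq : 0 < inner ℝ (v i) (N (v i)) - b) :
    ∃ N' : E →ₗ[ℝ] E, IsBarrier v (insert i σ) b N' ∧ ∀ x, inner ℝ x (N' x) =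
      inner ℝ x (N x) - inner ℝ x (N (v i)) ^ 2 / (inner ℝ (v i) (N (v i)) - b) := by
  set q := inner ℝ (v i) (N (v i)) - b with hqdef
  set u := N (v i) with hu
  have hform : ∀ x, inner ℝ x ((N - q⁻¹ • ((innerₗ E u).smulRight u) : E →ₗ[ℝ] E) x) =
      inner ℝ x (N x) - inner ℝ x u ^ 2 / q := by
    intro x
    simp only [LinearMap.sub_apply, LinearMap.smul_apply, LinearMap.smulRight_apply,
      innerₗ_apply_apply, inner_sub_right, real_inner_smul_right, real_inner_comm x u]
    ring
  refine ⟨N - q⁻¹ • ((innerₗ E u).smulRight u), ⟨?_, ?_⟩, hform⟩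
  · intro x y
    simp only [LinearMap.sub_apply, LinearMap.smul_apply, LinearMap.smulRight_apply,
      innerₗ_apply_apply, inner_sub_right, inner_sub_left, real_inner_smul_right,
      real_inner_smul_left, h.symm x y, real_inner_comm x u]
    ring
  · intro x a
    rw [hform, Finset.sum_insert hi, Finset.sum_insert hi]
    have h1 := h.le (x - a i • v i) a
    rw [sub_sub] at h1
    have h2 : inner ℝ (x - a i • v i) (N (x - a i • v i)) =
        inner ℝ x (N x) - 2 * a i * inner ℝ x u + a i ^ 2 * (q + b) := by
      have : inner ℝ (v i) (N x) = inner ℝ x u := by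
        rw [hu, ← h.symm, real_inner_comm]
      simp only [map_sub, map_smul, inner_sub_right, inner_sub_left, real_inner_smul_right,
        real_inner_smul_left, this, hqdef, ← hu]
      ring
    -- Complete the square in `a i`.
    have h3 : inner ℝ x (N x) - inner ℝ x u ^ 2 / q ≤
        inner ℝ x (N x) - 2 * a i * inner ℝ x u + a i ^ 2 * q := by
      have : inner ℝ x (N x) - 2 * a i * inner ℝ x u + a i ^ 2 * q -
          (inner ℝ x (N x) - inner ℝ x u ^ 2 / q) = (a i * q - inner ℝ x u) ^ 2 / q := by
        field_simp
        ring
      have h4 : 0 ≤ (a i * q - inner ℝ x u) ^ 2 / q := by positivity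
      linarith
    linarith

/-- Lowering the barrier from `b` to `(1 - ε) b`. -/
theorem shift [FiniteDimensional ℝ E] (h : IsBarrier v σ b N) {ε : ℝ} (h0 : 0 ≤ ε)
    (hε : ε ≤ 1 / 4) :
    ∃ N' : E →ₗ[ℝ] E, IsBarrier v σ ((1 - ε) * b) N' ∧
      ∀ x, inner ℝ x (N x) + ε * (‖N' x‖ ^ 2 - 2 * ‖x‖ ^ 2) ≤ inner ℝ x (N' x) := by
  obtain ⟨N', hs', hN'⟩ := h.symm.exists_shift h.inner_le h0 (by linarith)
  refine ⟨N', ⟨hs', fun x a => ?_⟩, fun x => ?_⟩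
  · obtain ⟨y, hxy, hy⟩ := hN' x
    set z := ∑ j ∈ σ, a j • v j
    have h1 := h.le y a
    have h2 : 0 ≤ ‖y - z - N y‖ ^ 2 := by positivity
    have h3 : ‖x - z‖ ^ 2 = ‖y - z‖ ^ 2 - 2 * ε * inner ℝ (y - z) (N y) + ε ^ 2 * ‖N y‖ ^ 2 := by
      rw [show x - z = (y - z) - ε • N y by rw [hxy]; abel, norm_sub_sq_real,
        real_inner_smul_right, norm_smul, mul_pow, Real.norm_eq_abs, sq_abs]
      ring
    rw [norm_sub_sq_real] at h2
    have h4 : inner ℝ x (N' x) = (1 - ε) * (inner ℝ y (N y) - ε * ‖N y‖ ^ 2) := by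
      rw [hy, hxy, real_inner_smul_right, inner_sub_left, real_inner_smul_left,
        real_inner_self_eq_norm_sq]
    rw [h3, h4]
    have h5 := mul_le_mul_of_nonneg_left h1 (show 0 ≤ 1 - ε by linarith)
    have h6 := mul_nonneg h0 h2
    change (1 - ε) * inner ℝ y (N y) ≤ (1 - ε) * (‖y - z‖ ^ 2 - b * _) at h5
    linarith
  · obtain ⟨y, hxy, hy⟩ := hN' x
    have h1 := h.inner_le y
    have h2 := h.inner_le (N y)
    have h3 : inner ℝ y (N (N y)) = ‖N y‖ ^ 2 := by
      rw [← h.symm, real_inner_self_eq_norm_sq]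
    have h4 : inner ℝ x (N' x) = (1 - ε) * (inner ℝ y (N y) - ε * ‖N y‖ ^ 2) := by
      rw [hy, hxy, real_inner_smul_right, inner_sub_left, real_inner_smul_left,
        real_inner_self_eq_norm_sq]
    have h5 : inner ℝ x (N x) =
        inner ℝ y (N y) - 2 * ε * ‖N y‖ ^ 2 + ε ^ 2 * inner ℝ (N y) (N (N y)) := by
      rw [hxy, map_sub, map_smul]
      simp only [inner_sub_right, inner_sub_left, real_inner_smul_right,
        real_inner_smul_left, h3, real_inner_self_eq_norm_sq]
      ring
    have h6 : ‖N' x‖ ^ 2 = (1 - ε) ^ 2 * ‖N y‖ ^ 2 := by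
      rw [hy, norm_smul, mul_pow, Real.norm_eq_abs, sq_abs]
    have h7 : ‖x‖ ^ 2 = ‖y‖ ^ 2 - 2 * ε * inner ℝ y (N y) + ε ^ 2 * ‖N y‖ ^ 2 := by
      rw [hxy, norm_sub_sq_real, real_inner_smul_right, norm_smul, mul_pow, Real.norm_eq_abs,
        sq_abs]
      ring
    rw [h4, h5, h6, h7]
    have e1 := mul_nonneg (pow_nonneg h0 2) (sub_nonneg.2 h2)
    have e2 := mul_nonneg (mul_nonneg h0 (show 0 ≤ 1 + 4 * ε by linarith)) (sub_nonneg.2 h1)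
    have e3 := mul_nonneg (mul_nonneg h0 (show 0 ≤ 1 - 4 * ε by linarith)) (sq_nonneg ‖y‖)
    have e4 := mul_nonneg (mul_nonneg h0 (show 0 ≤ ε * (2 + ε) by positivity)) (sq_nonneg ‖N y‖)
    linarith

/-- One round of the barrier argument: a vector is added at bounded cost. -/
theorem exists_insert [DecidableEq ι] [FiniteDimensional ℝ E] (h : IsBarrier v σ b N)
    {S : Finset ι} (hb : 0 < b) (hb8 : b ≤ 1 / 8) {L : ℝ} (hL : 0 < L)
    (hm : 64 * L ^ 2 ≤ S.card) (hv : ∑ j ∈ S, ‖v j‖ ^ 2 ≤ S.card)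
    (hT : ∀ u, ∑ j ∈ S, inner ℝ (v j) u ^ 2 ≤ L ^ 2 * ‖u‖ ^ 2)
    (hΦ : (S.card : ℝ) / 2 ≤ ∑ j ∈ S, inner ℝ (v j) (N (v j))) :
    ∃ i ∈ S \ σ, ∃ N' : E →ₗ[ℝ] E,
      IsBarrier v (Insert.insert i σ) ((1 - 4 * L ^ 2 / S.card) * b) N' ∧
      ∑ j ∈ S, inner ℝ (v j) (N (v j)) - 12 * L ^ 2 ≤ ∑ j ∈ S, inner ℝ (v j) (N' (v j)) := by
  set m : ℝ := (S.card : ℝ)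
  have hL2 : 0 < L ^ 2 := by positivity
  have hm0 : 0 < m := by linarith
  -- With this `ε`, the shift's gain `ε * s` offsets the insertion cost, of average order `4 L² s /
  -- m`; the net loss is `3 ε m = 12 L²`.
  set ε := 4 * L ^ 2 / m with hεdef
  have hεm : ε * m = 4 * L ^ 2 := by rw [hεdef]; field_simp
  have hε0 : 0 < ε := by positivity
  have hε : ε ≤ 1 / 16 := by rw [hεdef, div_le_iff₀ hm0]; linarith
  obtain ⟨M, hM, hgain⟩ := h.shift hε0.le (by linarith)
  set b' := (1 - ε) * b
  have hb' : 0 < b' := mul_pos (by linarith) hb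
  have hb'8 : b' ≤ 1 / 8 := le_trans (mul_le_of_le_one_left hb.le (by linarith)) hb8
  set Φ := ∑ j ∈ S, inner ℝ (v j) (N (v j))
  set Φ' := ∑ j ∈ S, inner ℝ (v j) (M (v j))
  set s := ∑ j ∈ S, ‖M (v j)‖ ^ 2
  have hs : 0 ≤ s := Finset.sum_nonneg fun _ _ => by positivity
  have hΦ' : Φ + ε * (s - 2 * m) ≤ Φ' := by
    have h1 := Finset.sum_le_sum (s := S) fun j _ => hgain (v j)
    rw [Finset.sum_add_distrib, ← Finset.mul_sum, Finset.sum_sub_distrib, ← Finset.mul_sum] at h1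
    have h2 := mul_le_mul_of_nonneg_left hv hε0.le
    change Φ + ε * (s - 2 * _) ≤ Φ' at h1
    linarith
  have hbig : m / 4 ≤ Φ' - m * b' := by
    have h1 : 0 ≤ ε * s := by positivity
    have h2 := mul_le_mul_of_nonneg_left hb'8 hm0.le
    have h3 := mul_le_mul_of_nonneg_right hε hm0.le
    linarith
  -- Budget for one insertion; the extra `ε * m` makes the averaging inequality strict, even if `s =
  -- 0`.
  set κ := ε * (s + m)
  have hκ : 0 < κ := by positivity
  have hsum : 0 < ∑ i ∈ S, (κ * (inner ℝ (v i) (M (v i)) - b') -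
      ∑ j ∈ S, inner ℝ (v j) (M (v i)) ^ 2) := by
    rw [Finset.sum_sub_distrib, ← Finset.mul_sum, Finset.sum_sub_distrib, Finset.sum_const,
      nsmul_eq_mul]
    have h1 : ∑ i ∈ S, ∑ j ∈ S, inner ℝ (v j) (M (v i)) ^ 2 ≤ L ^ 2 * s := by
      rw [Finset.mul_sum]
      exact Finset.sum_le_sum fun i _ => hT _
    have h2 := mul_le_mul_of_nonneg_left hbig hκ.le
    have h3 : κ * (m / 4) = L ^ 2 * (s + m) := by
      calc κ * (m / 4) = (ε * m) * (s + m) / 4 := by ring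
        _ = _ := by rw [hεm]; ring
    have h4 : 0 < L ^ 2 * m := by positivity
    change 0 < κ * (Φ' - m * b') - _
    linarith
  obtain ⟨i, hiS, hi⟩ := Finset.exists_lt_of_sum_lt (s := S) (f := fun _ => (0 : ℝ))
    (Finset.sum_const_zero.trans_lt hsum)
  have hl : 0 ≤ ∑ j ∈ S, inner ℝ (v j) (M (v i)) ^ 2 := Finset.sum_nonneg fun _ _ => by positivity
  have hq : 0 < inner ℝ (v i) (M (v i)) - b' := by
    refine pos_of_mul_pos_right (a := κ) ?_ hκ.le
    linarith
  have hiσ : i ∉ σ := fun hmem => by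
    have := hM.inner_le_of_mem hmem
    linarith
  obtain ⟨N', hN', hform⟩ := hM.insert hiσ hq
  refine ⟨i, Finset.mem_sdiff.2 ⟨hiS, hiσ⟩, N', hN', ?_⟩
  simp only [hform]
  rw [Finset.sum_sub_distrib, ← Finset.sum_div]
  have h1 : (∑ j ∈ S, inner ℝ (v j) (M (v i)) ^ 2) / (inner ℝ (v i) (M (v i)) - b') ≤ κ := by
    rw [div_le_iff₀ hq]
    linarith
  change _ ≤ Φ' - _
  have h2 : κ = ε * s + ε * m := mul_add _ _ _
  linarith

end IsBarrier

/-! ### Restricted invertibility -/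

/-- Restricted invertibility: if `m` vectors have mean square norm between `3 / 4` and `1` and
synthesis operator of norm at most `L`, then at least `m / (100 L²)` of them are well
conditioned. -/
theorem exists_restricted_invertibility [DecidableEq ι] [FiniteDimensional ℝ E] (v : ι → E)
    (S : Finset ι) {L : ℝ} (hL : 0 < L) (hv : ∑ j ∈ S, ‖v j‖ ^ 2 ≤ S.card)
    (hv' : 3 / 4 * (S.card : ℝ) ≤ ∑ j ∈ S, ‖v j‖ ^ 2)
    (hT : ∀ u, ∑ j ∈ S, inner ℝ (v j) u ^ 2 ≤ L ^ 2 * ‖u‖ ^ 2) :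
    ∃ σ ⊆ S, 1 / 100 * ((S.card : ℝ) / L ^ 2) ≤ σ.card ∧
      ∀ a : ι → ℝ, 1 / 512 * ∑ j ∈ σ, a j ^ 2 ≤ ‖∑ j ∈ σ, a j • v j‖ ^ 2 := by
  have hL2 : 0 < L ^ 2 := by positivity
  rcases S.eq_empty_or_nonempty with rfl | hS
  · exact ⟨∅, subset_rfl, by simp, fun a => by simp⟩
  have hm0 : (0 : ℝ) < S.card := by exact_mod_cast hS.card_pos
  rcases le_or_gt (64 * L ^ 2) (S.card : ℝ) with hm | hm
  · have key : ∀ k : ℕ, 48 * k * L ^ 2 ≤ S.card → ∃ σ ⊆ S, σ.card = k ∧ ∃ N : E →ₗ[ℝ] E,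
        IsBarrier v σ ((1 - 4 * L ^ 2 / S.card) ^ k * (1 / 8)) N ∧
        3 / 4 * (S.card : ℝ) - 12 * k * L ^ 2 ≤ ∑ j ∈ S, inner ℝ (v j) (N (v j)) := by
      have hε : 4 * L ^ 2 / S.card ≤ 1 / 16 := by rw [div_le_iff₀ hm0]; linarith
      have hε0 : 0 ≤ 4 * L ^ 2 / S.card := by positivity
      intro k
      induction k with
      | zero =>
        intro _
        refine ⟨∅, by simp, rfl, LinearMap.id, IsBarrier.empty v _, ?_⟩
        simpa [real_inner_self_eq_norm_sq] using hv'
      | succ k ih =>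
        intro hk
        push_cast at hk
        obtain ⟨σ, hσ, hc, N, hN, hΦ⟩ := ih (by linarith)
        obtain ⟨i, hi, N', hN', hΦ'⟩ := hN.exists_insert
          (mul_pos (pow_pos (by linarith) _) (by norm_num))
          (mul_le_of_le_one_left (by norm_num) (pow_le_one₀ (by linarith) (by linarith)))
          hL hm hv hT (by linarith)
        rw [Finset.mem_sdiff] at hi
        refine ⟨insert i σ, Finset.insert_subset hi.1 hσ, by rw [Finset.card_insert_of_notMem hi.2, hc],
          N', by rwa [pow_succ', mul_assoc], ?_⟩
        push_cast
        linarith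
    -- `k` losses of `12 L²` take the potential from `3m/4` to no less than `m/2`, where `m = |S|`.
    set k := ⌊(S.card : ℝ) / (48 * L ^ 2)⌋₊
    have hk : (k : ℝ) ≤ S.card / (48 * L ^ 2) := Nat.floor_le (by positivity)
    have hk' : (S.card : ℝ) / (48 * L ^ 2) < k + 1 := Nat.lt_floor_add_one _
    have hk1 : (1 : ℝ) ≤ k := by
      have : 1 ≤ k := by
        rw [Nat.one_le_floor_iff, one_le_div (by positivity)]
        linarith
      exact_mod_cast this
    rw [le_div_iff₀ (by positivity)] at hk
    obtain ⟨σ, hσ, hc, N, hN, -⟩ := key k (by linarith)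
    refine ⟨σ, hσ, ?_, fun a => ?_⟩
    · rw [hc]
      have : (S.card : ℝ) / (48 * L ^ 2) = S.card / L ^ 2 / 48 := by field_simp
      have h0 : 0 ≤ (S.card : ℝ) / L ^ 2 := by positivity
      linarith
    · refine le_trans (mul_le_mul_of_nonneg_right ?_ (Finset.sum_nonneg fun _ _ => sq_nonneg _))
        (hN.le_norm_sum a)
      have hε : 4 * L ^ 2 / S.card ≤ 1 / 16 := by rw [div_le_iff₀ hm0]; linarith
      have h1 := one_add_mul_le_pow (a := -(4 * L ^ 2 / S.card)) (by linarith) k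
      have h2 : k * (4 * L ^ 2 / S.card) ≤ 1 / 12 := by
        rw [mul_div_assoc', div_le_iff₀ hm0]
        linarith
      rw [← sub_eq_add_neg] at h1
      linarith
  -- Here `m / (100 L²) < 1`, so one vector of square norm at least `3/4` suffices.
  · obtain ⟨i, hiS, hi⟩ := Finset.exists_le_of_sum_le (s := S) hS
      (f := fun _ => (3 / 4 : ℝ)) (g := fun j => ‖v j‖ ^ 2)
      (by rw [Finset.sum_const, nsmul_eq_mul]; linarith)
    refine ⟨{i}, by simpa using hiS, ?_, fun a => ?_⟩
    · rw [Finset.card_singleton, Nat.cast_one]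
      have : (S.card : ℝ) / L ^ 2 ≤ 64 := by
        rw [div_le_iff₀ hL2]
        exact hm.le
      linarith
    · rw [Finset.sum_singleton, Finset.sum_singleton, norm_smul, mul_pow, Real.norm_eq_abs, sq_abs]
      nlinarith [sq_nonneg (a i)]

/-- Restricted invertibility modulo the span of a small family. -/
theorem exists_restricted_invertibility_union [DecidableEq ι] [FiniteDimensional ℝ E] (v : ι → E)
    (S ρ : Finset ι) {L : ℝ} (hL : 0 < L) (hv : ∀ j ∈ S, ‖v j‖ = 1)
    (hT : ∀ u, ∑ j ∈ S, inner ℝ (v j) u ^ 2 ≤ L ^ 2 * ‖u‖ ^ 2)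
    (hρ : (ρ.card : ℝ) * L ^ 2 ≤ 1 / 4 * S.card) :
    ∃ σ ⊆ S, Disjoint ρ σ ∧ 1 / 100 * ((S.card : ℝ) / L ^ 2) ≤ σ.card ∧
      ∀ ρ' ⊆ ρ, ∀ σ' ⊆ σ, ∀ a : ι → ℝ,
        1 / 512 * ∑ j ∈ σ', a j ^ 2 ≤ ‖∑ j ∈ ρ' ∪ σ', a j • v j‖ ^ 2 := by
  classical
  set K : Submodule ℝ E := Submodule.span ℝ (ρ.image v : Set E) with hK
  set P := Kᗮ.starProjection with hP
  have hPle : ∀ x, ‖P x‖ ≤ ‖x‖ := fun x => Kᗮ.norm_starProjection_apply_le x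
  have hPρ : ∀ j ∈ ρ, P (v j) = 0 := by
    intro j hj
    rw [hP, Submodule.starProjection_apply_eq_zero_iff, Submodule.orthogonal_orthogonal]
    exact Submodule.subset_span (by simpa using ⟨j, hj, rfl⟩)
  have hrank : (Module.finrank ℝ K : ℝ) ≤ ρ.card := by
    have := (finrank_span_finset_le_card (R := ℝ) (ρ.image v)).trans Finset.card_image_le
    exact_mod_cast this
  -- Apply `hT` to each vector of an orthonormal basis of `K`.
  have hQ : ∑ j ∈ S, ‖K.starProjection (v j)‖ ^ 2 ≤ ρ.card * L ^ 2 := by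
    let u := stdOrthonormalBasis ℝ K
    have h1 : ∀ x, ‖K.starProjection x‖ ^ 2 = ∑ i, inner ℝ x (u i : E) ^ 2 := by
      intro x
      rw [Submodule.starProjection_apply, ← Submodule.coe_norm, ← u.sum_sq_norm_inner_right]
      refine Finset.sum_congr rfl fun i _ => ?_
      rw [Real.norm_eq_abs, sq_abs, Submodule.inner_orthogonalProjectionOnto_eq_of_mem_left,
        real_inner_comm]
    simp only [h1]
    rw [Finset.sum_comm]
    calc ∑ i, ∑ j ∈ S, inner ℝ (v j) (u i : E) ^ 2 ≤ ∑ i : Fin (Module.finrank ℝ K), L ^ 2 := by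
          refine Finset.sum_le_sum fun i _ => (hT _).trans ?_
          have : ‖(u i : E)‖ = 1 := u.orthonormal.1 i
          rw [this]
          simp
      _ = Module.finrank ℝ K * L ^ 2 := by simp
      _ ≤ _ := by gcongr
  have hsplit : ∀ j ∈ S, ‖P (v j)‖ ^ 2 = 1 - ‖K.starProjection (v j)‖ ^ 2 := by
    intro j hj
    have := K.norm_sq_eq_add_norm_sq_starProjection (v j)
    rw [hv j hj] at this
    linarith
  have hsum : ∑ j ∈ S, ‖P (v j)‖ ^ 2 = S.card - ∑ j ∈ S, ‖K.starProjection (v j)‖ ^ 2 := by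
    rw [Finset.sum_congr rfl hsplit, Finset.sum_sub_distrib]
    simp
  obtain ⟨σ, hσ, hc, hlow⟩ := exists_restricted_invertibility (fun j => P (v j)) S hL
    (by
      rw [hsum]
      have : 0 ≤ ∑ j ∈ S, ‖K.starProjection (v j)‖ ^ 2 := Finset.sum_nonneg fun _ _ => by positivity
      linarith)
    (by rw [hsum]; linarith)
    (by
      intro u
      have h1 : ∀ j, inner ℝ (P (v j)) u = inner ℝ (v j) (P u) :=
        fun j => Kᗮ.inner_starProjection_left_eq_right _ _
      simp only [h1]
      refine (hT _).trans ?_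
      have := hPle u
      gcongr)
  -- A common index would have projection zero, against the lower bound.
  have hdisj : Disjoint ρ σ := by
    rw [Finset.disjoint_left]
    intro i hiρ hiσ
    have := hlow (Pi.single i 1)
    rw [Finset.sum_eq_single_of_mem i hiσ (by intro j _ hj; simp [hj]),
      Finset.sum_eq_single_of_mem i hiσ (by intro j _ hj; simp [hj])] at this
    simp [hPρ i hiρ] at this
    norm_num at this
  refine ⟨σ, hσ, hdisj, hc, fun ρ' hρ' σ' hσ' a => ?_⟩
  have h1 : P (∑ j ∈ ρ' ∪ σ', a j • v j) = ∑ j ∈ σ', a j • P (v j) := by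
    rw [Finset.sum_union (hdisj.mono hρ' hσ'), map_add, map_sum, map_sum]
    simp only [map_smul]
    rw [Finset.sum_eq_zero fun j hj => by rw [hPρ j (hρ' hj), smul_zero], zero_add]
  have h2 := hlow fun j => if j ∈ σ' then a j else 0
  have h3 : ∑ j ∈ σ, (if j ∈ σ' then a j else 0) ^ 2 = ∑ j ∈ σ', a j ^ 2 := by
    rw [← Finset.sum_subset hσ' (fun j _ hj => by simp [hj])]
    exact Finset.sum_congr rfl fun j hj => by simp [hj]
  have h4 : ∑ j ∈ σ, (if j ∈ σ' then a j else 0) • P (v j) = ∑ j ∈ σ', a j • P (v j) := by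
    rw [← Finset.sum_subset hσ' (fun j _ hj => by simp [hj])]
    exact Finset.sum_congr rfl fun j hj => by simp [hj]
  rw [h3, h4, ← h1] at h2
  exact h2.trans (pow_le_pow_left₀ (norm_nonneg _) (hPle _) 2)

end RestrictedInvertibility

/-! ### Columns of a matrix and the main theorem -/

theorem inner_matrixCol {n : ℕ} (A : Matrix (Fin n) (Fin n) ℝ) (j : Fin n)
    (u : EuclideanSpace ℝ (Fin n)) :
    inner ℝ (matrixCol A j) u = Matrix.toEuclideanLin A.conjTranspose u j := by
  rw [matrixCol, ← LinearMap.adjoint_inner_right, ← Matrix.toEuclideanLin_conjTranspose_eq_adjoint,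
    EuclideanSpace.inner_single_left]
  simp

theorem sum_inner_matrixCol_sq_le {n : ℕ} (A : Matrix (Fin n) (Fin n) ℝ) (S : Finset (Fin n))
    (u : EuclideanSpace ℝ (Fin n)) :
    ∑ j ∈ S, inner ℝ (matrixCol A j) u ^ 2 ≤ ‖A‖ ^ 2 * ‖u‖ ^ 2 := by
  calc ∑ j ∈ S, inner ℝ (matrixCol A j) u ^ 2 ≤ ∑ j, inner ℝ (matrixCol A j) u ^ 2 :=
        Finset.sum_le_sum_of_subset_of_nonneg (Finset.subset_univ _) fun _ _ _ => sq_nonneg _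
    _ = ‖Matrix.toEuclideanLin A.conjTranspose u‖ ^ 2 := by
        simp only [inner_matrixCol, EuclideanSpace.real_norm_sq_eq]
    _ ≤ (‖A‖ * ‖u‖) ^ 2 := by
        refine pow_le_pow_left₀ (norm_nonneg _) ?_ 2
        rw [← Matrix.l2_opNorm_conjTranspose A]
        exact Matrix.l2_opNorm_mulVec A.conjTranspose u
    _ = _ := mul_pow _ _ _

theorem one_le_norm_of_norm_matrixCol {n : ℕ} (A : Matrix (Fin n) (Fin n) ℝ) {i : Fin n}
    (hi : ‖matrixCol A i‖ = 1) : 1 ≤ ‖A‖ := by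
  have := Matrix.l2_opNorm_mulVec A (EuclideanSpace.single i (1 : ℝ))
  rw [PiLp.norm_single, norm_one, mul_one] at this
  exact hi.symm.le.trans this

theorem theorem4p1 :
    ∃ d₁ d₂ d₃ : ℝ, 1 > d₁ ∧ d₁ > d₂ ∧ d₂ > d₃ ∧ d₃ > 0 ∧
      ∀ (n : ℕ) (A : Matrix (Fin n) (Fin n) ℝ), (∀ i : Fin n, ‖matrixCol A i‖ = 1) →
        ∀ σ₁ : Finset (Fin n), (σ₁.card : ℝ) ≤ d₁ * n * ‖A‖ ^ (-2 : ℤ) →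
          ∃ σ₂ : Finset (Fin n), Disjoint σ₁ σ₂ ∧
            (σ₂.card : ℝ) ≥ d₂ * n * ‖A‖ ^ (-2 : ℤ) ∧
            (∀ a : Fin n → ℝ,
              ‖∑ j ∈ σ₁ ∪ σ₂, a j • matrixCol A j‖ ≥
                1 / (16 * Real.sqrt 2) * Real.sqrt (∑ j ∈ σ₂, |a j| ^ 2)) ∧
            ((σ₁.card : ℝ) ≥ d₂ * n * ‖A‖ ^ (-2 : ℤ) →
              d₁ * d₂ * n * ‖A‖ ^ (-4 : ℤ) ≥ 1 →
              ∃ τ₁ ⊆ σ₁, ∃ σ₂' ⊆ σ₂,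
                (τ₁.card : ℝ) ≥ d₃ * n * ‖A‖ ^ (-4 : ℤ) ∧
                (σ₂'.card : ℝ) ≥ d₃ * n * ‖A‖ ^ (-4 : ℤ) ∧
                ∀ a : Fin n → ℝ,
                  ‖∑ j ∈ τ₁ ∪ σ₂', a j • matrixCol A j‖ ≥
                    1 / 32 * Real.sqrt (∑ j ∈ τ₁ ∪ σ₂', |a j| ^ 2)) := by
  refine ⟨1 / 4, 1 / 100, 1 / 10000, by norm_num, by norm_num, by norm_num, by norm_num, ?_⟩
  intro n A hA σ₁ hσ₁
  rcases Nat.eq_zero_or_pos n with rfl | hn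
  · refine ⟨∅, Finset.disjoint_empty_right _, by simp, fun a => by simp, fun _ h => ?_⟩
    norm_num at h
  have hL1 : 1 ≤ ‖A‖ := one_le_norm_of_norm_matrixCol A (hA ⟨0, hn⟩)
  set L := ‖A‖
  have hL : 0 < L := by linarith
  have hL2 : 0 < L ^ 2 := by positivity
  have hz2 : L ^ (-2 : ℤ) = (L ^ 2)⁻¹ := by rw [zpow_neg]; norm_cast
  have hz4 : L ^ (-4 : ℤ) = (L ^ 2)⁻¹ * (L ^ 2)⁻¹ := by
    rw [zpow_neg, ← mul_inv, ← pow_add]; norm_cast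
  have hinv : (L ^ 2)⁻¹ ≤ 1 := inv_le_one_of_one_le₀ (one_le_pow₀ hL1)
  have hinv0 : 0 < (L ^ 2)⁻¹ := by positivity
  rw [hz2] at hσ₁ ⊢
  rw [hz4]
  obtain ⟨σ₂, -, hdisj, hcard, hlow⟩ := exists_restricted_invertibility_union (matrixCol A)
    Finset.univ σ₁ hL (fun j _ => hA j) (sum_inner_matrixCol_sq_le A _) (by
      rwa [Finset.card_univ, Fintype.card_fin, ← le_div_iff₀ hL2, div_eq_mul_inv])
  rw [Finset.card_univ, Fintype.card_fin, div_eq_mul_inv (n : ℝ)] at hcard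
  refine ⟨σ₂, hdisj, by linarith, fun a => ?_, fun hσ₁' hone => ?_⟩
  · have h := hlow σ₁ subset_rfl σ₂ subset_rfl a
    simp only [sq_abs]
    refine le_of_sq_le_sq ?_ (norm_nonneg _)
    rw [mul_pow, Real.sq_sqrt (Finset.sum_nonneg fun _ _ => sq_nonneg _), div_pow, mul_pow,
      Real.sq_sqrt (by norm_num)]
    norm_num at h ⊢
    exact h
  set t : ℝ := n * ((L ^ 2)⁻¹ * (L ^ 2)⁻¹) with ht
  have htn : t ≤ n * (L ^ 2)⁻¹ := by
    rw [ht, ← mul_assoc]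
    exact mul_le_of_le_one_right (by positivity) hinv
  have hone' : 1 ≤ 1 / 400 * t := by
    rw [ht]; linarith
  -- The largest size for which `ρ` is surely small enough relative to `σ₁`; nonzero because `d₁ d₂
  -- = 1/400`.
  set k := ⌊1 / 400 * t⌋₊
  have hk : (k : ℝ) ≤ 1 / 400 * t := Nat.floor_le (by linarith)
  have hk' : 1 / 400 * t < k + 1 := Nat.lt_floor_add_one _
  have hk1 : (1 : ℝ) ≤ k := by
    have : 1 ≤ k := by rwa [Nat.one_le_floor_iff]
    exact_mod_cast this
  obtain ⟨ρ, hρ, hρk⟩ := Finset.exists_subset_card_eq (s := σ₂) (n := k) (by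
    have : (k : ℝ) ≤ σ₂.card := by linarith
    exact_mod_cast this)
  have hσt : 1 / 100 * t ≤ (σ₁.card : ℝ) / L ^ 2 := by
    rw [div_eq_mul_inv (σ₁.card : ℝ), ht]
    have := mul_le_mul_of_nonneg_right hσ₁' hinv0.le
    linarith
  obtain ⟨τ, hτ, hρτ, hτcard, hτlow⟩ := exists_restricted_invertibility_union (matrixCol A)
    σ₁ ρ hL (fun j _ => hA j) (sum_inner_matrixCol_sq_le A _) (by
      rw [hρk, ← le_div_iff₀ hL2, mul_div_assoc]
      linarith)
  refine ⟨τ, hτ, ρ, hρ, by linarith, by rw [hρk]; linarith, fun a => ?_⟩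
  -- `h1` controls the coefficients on `ρ`, `h2` those on `τ`; their average has constant `1/1024 =
  -- (1/32)²`.
  have h1 := hlow τ hτ ρ hρ a
  have h2 := hτlow ρ subset_rfl τ subset_rfl a
  rw [Finset.union_comm ρ τ] at h2
  simp only [sq_abs]
  refine le_of_sq_le_sq ?_ (norm_nonneg _)
  rw [mul_pow, Real.sq_sqrt (Finset.sum_nonneg fun _ _ => sq_nonneg _),
    Finset.sum_union hρτ.symm]
  linarith
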